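/- Identify $\{0,1\}^n$ with $\mathbb F_2^n$. A function $f:\{0,1\}^n\to\{-1,1\}$ is folded if $f(\vec 1+x)=-f(x)$ for all $x$; the $i$-th dictator is $x\mapsto(-1)^{x_i}$. Put $\widehat f(\alpha)=\mathbb E_x f(x)(-1)^{\sum_i\alpha_ix_i}$ and $$I_i^{\le w}(f)=\sum_{\alpha:\ \alpha_i=1,\ |\alpha|\le w}\widehat f(\alpha)^2 .$$ An adaptive $t$-function dictatorship test (on folded functions) with $q$ queries, completeness $c$ and soundness $s$ consists, for every $n$, of a randomized adaptive algorithm that has oracle access to $f_1,\dots,f_t:\{0,1\}^n\to\{-1,1\}$, makes $q$ queries and accepts or rejects, such that * if for some $i\in[n]$ all of $f_1,\dots,f_t$ equal the $i$-th dictator, then it accepts with probability at least $c$; * for every $\epsilon>0$ there are a real $\tau>0$ and a positive integer $w$, independent of $n$ and of the functions, such that whenever $f_1,\dots,f_t$ are folded and are accepted with probability at least $s+\epsilon$, there are $a\ne b$ in $[t]$ and $i\in[n]$ with $I_i^{\le w}(f_a)\ge\tau$ and $I_i^{\le w}(f_b)\ge\tau$. **Theorem.** 1. For every $k\ge1$ and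 $t=2^k-1$ (hence for infinitely many $t$) there is an adaptive $t$-function dictatorship test with $t+\log_2(t+1)$ queries, completeness $1$ and soundness $\frac{(t+1)^2}{2^t}$. 2. There are constants $C,D>0$ such that for every integer $q\ge3$ there are an integer $t$ with $q-D\log_2 q\le t\le q$ and an adaptive $t$-function dictatorship test with $q$ queries, completeness $1$ and soundness $s_q=\frac{Cq^3}{2^q}$. Moreover, for every integer $q\ge 3$ with $s_q<1$ (hence for all large $q$), its amortized query complexity satisfies $$\frac{q}{\log_2(1/s_q)}\le 1+D\,\frac{\log_2 q}{q}.$$ -/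

import Mathlib

open scoped BigOperators

namespace DictatorshipTesting

/-- The boolean cube `{0,1}ⁿ`, with coordinatewise addition modulo 2. -/
abbrev Cube (n : ℕ) : Type := Fin n → ZMod 2

/-- Boolean functions `{0,1}ⁿ → {-1,1}`; the group `ℤˣ` of units of `ℤ` is exactly `{1,-1}`. -/
abbrev BoolFun (n : ℕ) : Type := Cube n → ℤˣ

/-- A boolean function regarded as a real-valued function. -/
def BoolFun.toReal {n : ℕ} (f : BoolFun n) : Cube n → ℝ := fun x => ((f x : ℤ) : ℝ)

/-- `|α|`, the number of ones of `α`. -/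
def weight {n : ℕ} (α : Cube n) : ℕ := ∑ i, (α i).val

/-- The character `χ_α(x) = (-1)^{∑ᵢ αᵢ xᵢ}`. -/
def character {n : ℕ} (α x : Cube n) : ℝ := (-1) ^ (∑ i, (α i).val * (x i).val)

/-- The Fourier coefficient of `f` at `α`, i.e. the average of `f(x) χ_α(x)` over the cube. -/
noncomputable def cubeFourierCoeff {n : ℕ} (f : Cube n → ℝ) (α : Cube n) : ℝ :=
  𝔼 x, f x * character α x

/-- The `w`-th degree influence of the `i`-th variable of `f`. -/
noncomputable def lowDegreeInfluence {n : ℕ} (w : ℕ) (i : Fin n) (f : Cube n → ℝ) : ℝ :=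
  ∑ α : Cube n with α i = 1 ∧ weight α ≤ w, cubeFourierCoeff f α ^ 2

/-- The `i`-th dictator `x ↦ (-1)^{xᵢ}`. -/
def dictator {n : ℕ} (i : Fin n) : BoolFun n := fun x => (-1) ^ (x i).val

/-- `f` is folded: flipping all input bits negates the value. -/
def Folded {n : ℕ} (f : BoolFun n) : Prop := ∀ x, f (1 + x) = - f x

/-- Deterministic adaptive query strategies with oracle access to `t` boolean functions on
`{0,1}ⁿ`, making `q` queries (on every branch). Each query is to one of the `t` functions at one
point, and everything that follows may depend on the answers received so far. -/
inductive QueryTree (t n : ℕ) : ℕ → Type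
  | decide (accept : Bool) : QueryTree t n 0
  | query {q : ℕ} (a : Fin t) (x : Cube n) (next : ℤˣ → QueryTree t n q) : QueryTree t n (q + 1)

/-- The decision taken when the oracles are `f 0, …, f (t - 1)`. -/
def QueryTree.run {t n : ℕ} (f : Fin t → BoolFun n) : {q : ℕ} → QueryTree t n q → Bool
  | _, .decide accept => accept
  | _, .query a x next => QueryTree.run f (next (f a x))

/-- A randomized adaptive tester making `q` queries: it draws an element uniformly at random from
a finite nonempty set and then follows the corresponding deterministic adaptive strategy. -/
structure Tester (t n q : ℕ) where
  Coins : Type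
  [fintypeCoins : Fintype Coins]
  [nonemptyCoins : Nonempty Coins]
  strategy : Coins → QueryTree t n q

attribute [instance] Tester.fintypeCoins Tester.nonemptyCoins

/-- The probability that the tester accepts when given oracle access to `f`. -/
noncomputable def Tester.acceptProb {t n q : ℕ} (T : Tester t n q) (f : Fin t → BoolFun n) : ℝ :=
  (Finset.card {r : T.Coins | (T.strategy r).run f = true} : ℝ) / Fintype.card T.Coins

/-- `T` (one tester for every number `n` of variables) is a `t`-function dictatorship test on
folded boolean functions with completeness `c` and soundness `s`. The constants `τ` and `w` are
independent of `n` and of the functions. Dictators are folded, so completeness needs no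
extra hypothesis. -/
def IsDictatorshipTest {t q : ℕ} (T : (n : ℕ) → Tester t n q) (c s : ℝ) : Prop :=
  (∀ (n : ℕ) (f : Fin t → BoolFun n) (i : Fin n),
    (∀ a, f a = dictator i) → c ≤ (T n).acceptProb f) ∧
  (∀ ε : ℝ, 0 < ε → ∃ τ : ℝ, 0 < τ ∧ ∃ w : ℕ, 0 < w ∧
    ∀ (n : ℕ) (f : Fin t → BoolFun n), (∀ a, Folded (f a)) →
      s + ε ≤ (T n).acceptProb f →
      ∃ a b : Fin t, a ≠ b ∧ ∃ i : Fin n,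
        τ ≤ lowDegreeInfluence w i (f a).toReal ∧ τ ≤ lowDegreeInfluence w i (f b).toReal)

/-- There is an adaptive `t`-function dictatorship test on folded boolean functions that makes
`q` queries and has completeness `c` and soundness `s`. -/
def HasDictatorshipTest (t q : ℕ) (c s : ℝ) : Prop :=
  ∃ T : (n : ℕ) → Tester t n q, IsDictatorshipTest T c s

/-- The amortized query complexity `q / log₂(1/s)`, meaningful for `0 < s < 1`. -/
noncomputable def amortizedQueryComplexity (q : ℕ) (s : ℝ) : ℝ := q / Real.logb 2 s⁻¹

end DictatorshipTesting

/-!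
The test has perfect completeness for the following reason. It queries a function at uniform points
`x, y₁, …, y_k`; call the answers `b₀, b₁, …, b_k`. Let `A` be the set of coordinates whose dictators
take the value `b₀` at `x` (`agreeSet`). For each of `m` distinct nonzero vectors `S a ∈ 𝔽₂ᵏ`, a
separate function is queried at the point that equals `∑ᵢ (S a)ᵢ yᵢ` on `A` and is uniformly random
off `A`, and its value is compared with `∏ᵢ bᵢ ^ (S a)ᵢ` (`linearFormTester`). If all functions are
the `j`-th dictator, then `j ∈ A`, and every comparison succeeds.

For soundness, a union bound over the `2 ^ (k + 1)` possible answers `b` removes all adaptivity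
(`acceptProb_le_sum`). For fixed `b` the set `A` is a uniformly random set of coordinates, and the
probability that all comparisons succeed is the expectation of a product of `[0, 1]`-valued
functions of mean `1 / 2`, the functions being folded. If the points were independent it would be
`2 ^ (-m)`. The points are only pairwise independent, and the two expectations are compared by
replacing the coordinates in `A` one at a time (`abs_linExpect_sub_le`). The effect of coordinate
`j` is a sum of expectations of products in which at least one function is replaced by its
derivative in direction `j` (`linExpect_insert_sub`). With one or two derivatives such an
expectation vanishes (`expect_revealTerm_eq_zero`, `two_lt_card_of_sum_eq_zero`). With three, say
`d₁, d₂, d₃`, it is at most `E |d₁ d₂ d₃| ≤ (r⁻¹ E d₁² E d₂² + r E d₃²) / 2` by pairwise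
independence, and `E dᵢ²` is an influence. If no coordinate is influential for two functions, then
one of two of the functions has small low-degree influence, and may be taken as the first one
(`abs_expect_revealTerm_le`).

It remains to sum over the coordinates. Averaging over the coordinates off `A` acts as noise: a
character of weight `d` survives with probability `2 ^ (-d)`. Hence the total influence is bounded
on average over `A`, and its part of degree more than `w` is `O(1 / w)`
(`expect_sum_influenceIn_le_one`, `expect_sum_highInfluenceIn_le`). The error is therefore as small
as desired for small `τ` and large `w`, and the test has `m + k + 1` queries and soundness
`2 ^ (k + 1) / 2 ^ m` (`hasDictatorshipTest_linearForms`). The rest is the choice of `k` and `m`.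
-/

namespace DictatorshipTesting

/-! ### Averages over finite products and finite groups -/

lemma expect_prod_pi {ι κ : Type*} [Fintype ι] [DecidableEq ι] [Fintype κ] (u : ι → κ → ℝ) :
    𝔼 x : ι → κ, ∏ i, u i (x i) = ∏ i, 𝔼 c, u i c := by
  simp only [Fintype.expect_eq_sum_div_card, Finset.prod_div_distrib, Finset.prod_univ_sum,
    Fintype.piFinset_univ]
  simp

lemma expect_add_right {G : Type*} [AddCommGroup G] [Fintype G] (F : G → ℝ) (c : G) :
    𝔼 x, F (x + c) = 𝔼 x, F x :=
  Fintype.expect_equiv (Equiv.addRight c) _ _ fun _ => rfl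

/-- A surjective homomorphism of finite groups transports the uniform distribution to the
uniform distribution. -/
lemma expect_comp_of_surjective {G H : Type*} [AddCommGroup G] [Fintype G] [AddCommGroup H]
    [Fintype H] (φ : G →+ H) (hφ : Function.Surjective φ) (F : H → ℝ) :
    𝔼 g, F (φ g) = 𝔼 h, F h := by
  have h1 : ∀ h : H, 𝔼 g, F (φ g + h) = 𝔼 g, F (φ g) := by
    intro h
    obtain ⟨c, rfl⟩ := hφ h
    simpa using expect_add_right (fun g => F (φ g)) c
  calc 𝔼 g, F (φ g) = 𝔼 h : H, 𝔼 g, F (φ g + h) := by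
        simp only [h1, Fintype.expect_const]
    _ = 𝔼 g : G, 𝔼 h : H, F (φ g + h) := Finset.expect_comm _ _ _
    _ = 𝔼 g : G, 𝔼 h : H, F h := by
        refine Finset.expect_congr rfl fun g _ => ?_
        simpa [add_comm] using expect_add_right F (φ g)
    _ = 𝔼 h, F h := Fintype.expect_const _

/-! ### Fourier analysis on the cube -/

lemma zmod_two_cases : ∀ a : ZMod 2, a = 0 ∨ a = 1 := by decide

lemma expect_zmod_two (u : ZMod 2 → ℝ) : 𝔼 c, u c = (u 0 + u 1) / 2 := by
  rw [Fintype.expect_eq_sum_div_card, ZMod.card]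
  congr 1
  exact Fin.sum_univ_two u

variable {n : ℕ}

lemma character_eq_prod (α x : Cube n) :
    character α x = ∏ i, (-1 : ℝ) ^ ((α i).val * (x i).val) := by
  rw [character, Finset.prod_pow_eq_pow_sum]

lemma character_comm (α x : Cube n) : character α x = character x α := by
  simp only [character, mul_comm]

lemma character_add_right (α x y : Cube n) :
    character α (x + y) = character α x * character α y := by
  simp only [character_eq_prod, ← Finset.prod_mul_distrib]
  refine Finset.prod_congr rfl fun i _ => ?_
  have h : (1 + 1 : ZMod 2) = 0 := rfl
  rcases zmod_two_cases (α i) with ha | ha <;> rcases zmod_two_cases (x i) with hx | hx <;>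
    rcases zmod_two_cases (y i) with hy | hy <;> simp [ha, hx, hy, h, ZMod.val_one]

lemma character_add_left (α β x : Cube n) :
    character (α + β) x = character α x * character β x := by
  rw [character_comm, character_add_right, character_comm x, character_comm x]

lemma character_single (α : Cube n) (j : Fin n) (c : ZMod 2) :
    character α (Pi.single j c) = (-1) ^ ((α j).val * c.val) := by
  rw [character_eq_prod, Finset.prod_eq_single j] <;> simp +contextual

lemma expect_character (α : Cube n) : 𝔼 x, character α x = if α = 0 then 1 else 0 := by
  simp only [character_eq_prod]
  rw [expect_prod_pi fun i (c : ZMod 2) => (-1 : ℝ) ^ ((α i).val * c.val)]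
  split_ifs with h
  · simp [h]
  · obtain ⟨i, hi⟩ := Function.ne_iff.1 h
    refine Finset.prod_eq_zero (Finset.mem_univ i) ?_
    have : α i = 1 := (zmod_two_cases _).resolve_left hi
    simp [this, expect_zmod_two, ZMod.val_one]

lemma cube_add_eq_zero_iff (α β : Cube n) : α + β = 0 ↔ α = β := by
  have h : -β = β := funext fun i => ZMod.neg_eq_self_mod_two _
  rw [add_eq_zero_iff_eq_neg, h]

lemma expect_character_mul (α β : Cube n) :
    𝔼 x, character α x * character β x = if α = β then 1 else 0 := by
  simp only [← character_add_left, expect_character, cube_add_eq_zero_iff]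

lemma expect_sq_sum_character (s : Finset (Cube n)) (a : Cube n → ℝ) :
    𝔼 x, (∑ α ∈ s, a α * character α x) ^ 2 = ∑ α ∈ s, a α ^ 2 := by
  simp only [sq, Finset.sum_mul_sum, Finset.expect_sum_comm]
  refine Finset.sum_congr rfl fun α hα => ?_
  have : ∀ β, 𝔼 x, a α * character α x * (a β * character β x)
      = a α * a β * if α = β then 1 else 0 := by
    intro β
    rw [← expect_character_mul, Finset.mul_expect]
    exact Finset.expect_congr rfl fun x _ => by ring
  simp [this, hα]

lemma sum_cubeFourierCoeff_mul_character (f : Cube n → ℝ) (x : Cube n) :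
    ∑ α, cubeFourierCoeff f α * character α x = f x := by
  have hcard : (Fintype.card (Cube n) : ℝ) ≠ 0 := by simp
  have h : ∀ y, ∑ α : Cube n, character α y * character α x
      = if y = x then (Fintype.card (Cube n) : ℝ) else 0 := by
    intro y
    have := expect_character_mul y x
    rw [Fintype.expect_eq_sum_div_card, div_eq_iff hcard] at this
    simp only [character_comm _ y, character_comm _ x, this]
    split_ifs <;> simp
  simp only [cubeFourierCoeff, Finset.expect_mul]
  rw [← Finset.expect_sum_comm]
  simp only [mul_assoc, ← Finset.mul_sum, h]
  rw [Fintype.expect_eq_sum_div_card]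
  simp

lemma sum_sq_cubeFourierCoeff (f : Cube n → ℝ) :
    ∑ α, cubeFourierCoeff f α ^ 2 = 𝔼 x, f x ^ 2 := by
  rw [← expect_sq_sum_character]
  simp only [sum_cubeFourierCoeff_mul_character]

lemma sum_sq_cubeFourierCoeff_le_one {f : Cube n → ℝ} (hf : ∀ x, |f x| ≤ 1) :
    ∑ α, cubeFourierCoeff f α ^ 2 ≤ 1 := by
  rw [sum_sq_cubeFourierCoeff]
  exact Finset.expect_le Finset.univ_nonempty fun x _ => (sq_le_one_iff_abs_le_one _).2 (hf x)

/-! ### Averaging over the coordinates outside a set -/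

/-- The point that agrees with `x` on `A` and with `z` off `A`. -/
def mix (A : Finset (Fin n)) (x z : Cube n) : Cube n := fun j => if j ∈ A then x j else z j

/-- The conditional expectation of `f` given the coordinates in `A`, for a uniform argument. -/
noncomputable def avgOff (A : Finset (Fin n)) (f : Cube n → ℝ) (x : Cube n) : ℝ :=
  𝔼 z, f (mix A x z)

/-- The vectors supported in `A`. -/
def supportedIn (A : Finset (Fin n)) : Finset (Cube n) := {α | ∀ j, j ∉ A → α j = 0}

lemma mem_supportedIn {A : Finset (Fin n)} {α : Cube n} :
    α ∈ supportedIn A ↔ ∀ j, j ∉ A → α j = 0 := by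
  simp [supportedIn]

lemma supportedIn_mono {A B : Finset (Fin n)} (h : A ⊆ B) : supportedIn A ⊆ supportedIn B :=
  fun _ hα => mem_supportedIn.2 fun j hj => mem_supportedIn.1 hα j fun hA => hj (h hA)

lemma mem_supportedIn_insert {A : Finset (Fin n)} {j : Fin n} (hj : j ∉ A) {α : Cube n} :
    α ∈ supportedIn A ↔ α ∈ supportedIn (insert j A) ∧ α j = 0 := by
  simp only [mem_supportedIn, Finset.mem_insert, not_or]
  refine ⟨fun h => ⟨fun i hi => h i hi.2, h j hj⟩, fun h i hi => ?_⟩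
  by_cases hij : i = j
  · exact hij ▸ h.2
  · exact h.1 i ⟨hij, hi⟩

lemma expect_character_mix (A : Finset (Fin n)) (α x : Cube n) :
    𝔼 z, character α (mix A x z) = if α ∈ supportedIn A then character α x else 0 := by
  simp only [character_eq_prod, mix]
  rw [expect_prod_pi fun i c => (-1 : ℝ) ^ ((α i).val * (if i ∈ A then x i else c).val)]
  split_ifs with h
  · refine Finset.prod_congr rfl fun i _ => ?_
    by_cases hi : i ∈ A
    · simp [hi]
    · simp [mem_supportedIn.1 h i hi]
  · simp only [mem_supportedIn, not_forall] at h
    obtain ⟨i, hi, hα⟩ := h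
    refine Finset.prod_eq_zero (Finset.mem_univ i) ?_
    have : α i = 1 := (zmod_two_cases _).resolve_left hα
    simp [this, hi, expect_zmod_two, ZMod.val_one]

lemma avgOff_eq_sum (A : Finset (Fin n)) (f : Cube n → ℝ) (x : Cube n) :
    avgOff A f x = ∑ α ∈ supportedIn A, cubeFourierCoeff f α * character α x := by
  rw [avgOff]
  conv_lhs => enter [2, z]; rw [← sum_cubeFourierCoeff_mul_character f (mix A x z)]
  rw [Finset.expect_sum_comm]
  simp only [← Finset.mul_expect, expect_character_mix]
  simp

lemma avgOff_empty (f : Cube n → ℝ) (x : Cube n) : avgOff ∅ f x = 𝔼 z, f z := by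
  have h : ∀ z, mix ∅ x z = z := fun z => funext fun j => by simp [mix]
  simp [avgOff, h]

lemma avgOff_nonneg {f : Cube n → ℝ} (hf : ∀ x, 0 ≤ f x) (A : Finset (Fin n)) (x : Cube n) :
    0 ≤ avgOff A f x :=
  Finset.expect_nonneg fun _ _ => hf _

lemma avgOff_le_one {f : Cube n → ℝ} (hf : ∀ x, f x ≤ 1) (A : Finset (Fin n)) (x : Cube n) :
    avgOff A f x ≤ 1 :=
  Finset.expect_le Finset.univ_nonempty fun _ _ => hf _

/-- The change of the conditional expectation when the coordinate `j` is revealed on top of `A`. -/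
noncomputable def reveal (A : Finset (Fin n)) (j : Fin n) (f : Cube n → ℝ) (x : Cube n) : ℝ :=
  avgOff (insert j A) f x - avgOff A f x

/-- The part of the influence of `j` on `f` that comes from characters supported in `A`; it is
the influence of `j` on `avgOff A f`. -/
noncomputable def influenceIn (A : Finset (Fin n)) (j : Fin n) (f : Cube n → ℝ) : ℝ :=
  ∑ α ∈ supportedIn A with α j = 1, cubeFourierCoeff f α ^ 2

/-- The contribution to `influenceIn` of the characters of weight more than `w`. -/
noncomputable def highInfluenceIn (w : ℕ) (A : Finset (Fin n)) (j : Fin n) (f : Cube n → ℝ) : ℝ :=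
  ∑ α ∈ supportedIn A with α j = 1 ∧ w < weight α, cubeFourierCoeff f α ^ 2

lemma reveal_eq_sum {A : Finset (Fin n)} {j : Fin n} (hj : j ∉ A) (f : Cube n → ℝ) (x : Cube n) :
    reveal A j f x =
      ∑ α ∈ supportedIn (insert j A) with α j = 1, cubeFourierCoeff f α * character α x := by
  rw [reveal, avgOff_eq_sum, avgOff_eq_sum, sub_eq_iff_eq_add,
    ← Finset.sum_filter_add_sum_filter_not (supportedIn (insert j A)) (fun α => α j = 1)]
  congr 1
  refine Finset.sum_congr ?_ fun _ _ => rfl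
  ext α
  rw [Finset.mem_filter, mem_supportedIn_insert hj]
  rcases zmod_two_cases (α j) with h | h <;> simp [h]

lemma expect_reveal_sq {A : Finset (Fin n)} {j : Fin n} (hj : j ∉ A) (f : Cube n → ℝ) :
    𝔼 x, reveal A j f x ^ 2 = influenceIn (insert j A) j f := by
  simp only [reveal_eq_sum hj]
  exact expect_sq_sum_character _ _

lemma avgOff_add_single {A : Finset (Fin n)} {j : Fin n} (hj : j ∉ A) (f : Cube n → ℝ)
    (x : Cube n) (c : ZMod 2) : avgOff A f (x + Pi.single j c) = avgOff A f x := by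
  refine Finset.expect_congr rfl fun z _ => congrArg f (funext fun i => ?_)
  simp only [mix]
  split_ifs with hi
  · have : i ≠ j := fun h => hj (h ▸ hi)
    simp [this]
  · rfl

lemma reveal_add_single {A : Finset (Fin n)} {j : Fin n} (hj : j ∉ A) (f : Cube n → ℝ)
    (x : Cube n) (c : ZMod 2) :
    reveal A j f (x + Pi.single j c) = (-1) ^ c.val * reveal A j f x := by
  rw [reveal_eq_sum hj, reveal_eq_sum hj, Finset.mul_sum]
  refine Finset.sum_congr rfl fun α hα => ?_
  rw [character_add_right, character_single, (Finset.mem_filter.1 hα).2, ZMod.val_one, one_mul]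
  ring

lemma abs_reveal_le_one {f : Cube n → ℝ} (h0 : ∀ x, 0 ≤ f x) (h1 : ∀ x, f x ≤ 1)
    (A : Finset (Fin n)) (j : Fin n) (x : Cube n) : |reveal A j f x| ≤ 1 := by
  rw [reveal, abs_le]
  constructor <;> linarith [avgOff_nonneg h0 A x, avgOff_le_one h1 A x,
    avgOff_nonneg h0 (insert j A) x, avgOff_le_one h1 (insert j A) x]

lemma influenceIn_nonneg (A : Finset (Fin n)) (j : Fin n) (f : Cube n → ℝ) :
    0 ≤ influenceIn A j f :=
  Finset.sum_nonneg fun _ _ => sq_nonneg _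

lemma highInfluenceIn_nonneg (w : ℕ) (A : Finset (Fin n)) (j : Fin n) (f : Cube n → ℝ) :
    0 ≤ highInfluenceIn w A j f :=
  Finset.sum_nonneg fun _ _ => sq_nonneg _

lemma influenceIn_mono {A B : Finset (Fin n)} (h : A ⊆ B) (j : Fin n) (f : Cube n → ℝ) :
    influenceIn A j f ≤ influenceIn B j f :=
  Finset.sum_le_sum_of_subset_of_nonneg (Finset.filter_subset_filter _ (supportedIn_mono h))
    fun _ _ _ => sq_nonneg _

lemma highInfluenceIn_mono (w : ℕ) {A B : Finset (Fin n)} (h : A ⊆ B) (j : Fin n)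
    (f : Cube n → ℝ) : highInfluenceIn w A j f ≤ highInfluenceIn w B j f :=
  Finset.sum_le_sum_of_subset_of_nonneg (Finset.filter_subset_filter _ (supportedIn_mono h))
    fun _ _ _ => sq_nonneg _

lemma influenceIn_le_one {f : Cube n → ℝ} (hf : ∀ x, |f x| ≤ 1) (A : Finset (Fin n)) (j : Fin n) :
    influenceIn A j f ≤ 1 :=
  (Finset.sum_le_sum_of_subset_of_nonneg (Finset.subset_univ _) fun _ _ _ => sq_nonneg _).trans
    (sum_sq_cubeFourierCoeff_le_one hf)

lemma influenceIn_le (w : ℕ) (A : Finset (Fin n)) (j : Fin n) (f : Cube n → ℝ) :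
    influenceIn A j f ≤ lowDegreeInfluence w j f + highInfluenceIn w A j f := by
  rw [influenceIn, ← Finset.sum_filter_add_sum_filter_not _ (fun α => weight α ≤ w)]
  refine add_le_add (Finset.sum_le_sum_of_subset_of_nonneg ?_ fun _ _ _ => sq_nonneg _) ?_
  · intro α
    simp only [Finset.mem_filter, Finset.mem_univ, true_and]
    tauto
  · refine Finset.sum_le_sum_of_subset_of_nonneg ?_ fun _ _ _ => sq_nonneg _
    intro α
    simp only [Finset.mem_filter, not_le]
    tauto


/-! ### Linear forms over the field with two elements -/

lemma neg_one_pow_val_add {M : Type*} [Monoid M] [HasDistribNeg M] (a b : ZMod 2) :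
    (-1 : M) ^ (a + b).val = (-1) ^ a.val * (-1) ^ b.val := by
  have h : (1 + 1 : ZMod 2) = 0 := rfl
  rcases zmod_two_cases a with rfl | rfl <;> rcases zmod_two_cases b with rfl | rfl <;>
    simp [h, ZMod.val_one]

lemma neg_one_pow_val_sum {M ι : Type*} [CommMonoid M] [HasDistribNeg M] (s : Finset ι)
    (u : ι → ZMod 2) : (-1 : M) ^ (∑ i ∈ s, u i).val = ∏ i ∈ s, (-1) ^ (u i).val := by
  classical
  induction s using Finset.induction_on with
  | empty => simp
  | insert a s ha ih => rw [Finset.sum_insert ha, Finset.prod_insert ha, neg_one_pow_val_add, ih]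

variable {k m : ℕ}

/-- The linear form with coefficient vector `s`, applied to `k` points of the cube. -/
def linForm (s : Fin k → ZMod 2) (y : Fin k → Cube n) : Cube n := ∑ i, s i • y i

lemma linForm_apply (s : Fin k → ZMod 2) (y : Fin k → Cube n) (j : Fin n) :
    linForm s y j = ∑ i, s i * y i j := by
  simp [linForm]

lemma linForm_add (s : Fin k → ZMod 2) (y y' : Fin k → Cube n) :
    linForm s (y + y') = linForm s y + linForm s y' := by
  simp [linForm, Finset.sum_add_distrib]

lemma linForm_single (s : Fin k → ZMod 2) (i : Fin k) (x : Cube n) :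
    linForm s (Pi.single i x) = s i • x := by
  rw [linForm, Finset.sum_eq_single i] <;> simp +contextual

/-- Two different nonzero linear forms take independent uniform values. -/
lemma linForm_pair_surjective {s s' : Fin k → ZMod 2} (hs : s ≠ 0) (hs' : s' ≠ 0) (h : s ≠ s')
    (u u' : Cube n) : ∃ y, linForm s y = u ∧ linForm s' y = u' := by
  have hdbl : ∀ x : Cube n, x + x = 0 := fun x => (cube_add_eq_zero_iff x x).2 rfl
  -- It suffices to treat a coordinate that occurs in the first form only.
  have key : ∀ {s s' : Fin k → ZMod 2} (i : Fin k), s i = 1 → s' i = 0 → s' ≠ 0 →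
      ∀ u u' : Cube n, ∃ y, linForm s y = u ∧ linForm s' y = u' := by
    intro s s' i hi hi' hs' u u'
    obtain ⟨l, hl⟩ := Function.ne_iff.1 hs'
    have hl1 : s' l = 1 := (zmod_two_cases _).resolve_left hl
    refine ⟨Pi.single l u' + Pi.single i (u + s l • u'), ?_, ?_⟩
    · rw [linForm_add, linForm_single, linForm_single, hi, one_smul, add_left_comm, hdbl, add_zero]
    · rw [linForm_add, linForm_single, linForm_single, hi', hl1, one_smul, zero_smul, add_zero]
  obtain ⟨i, hi⟩ := Function.ne_iff.1 h
  rcases zmod_two_cases (s i) with h0 | h1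
  · have h1' : s' i = 1 := (zmod_two_cases _).resolve_left fun h' => hi (h0.trans h'.symm)
    obtain ⟨y, hy⟩ := key i h1' h0 hs u' u
    exact ⟨y, hy.symm⟩
  · have h0' : s' i = 0 := (zmod_two_cases _).resolve_right fun h' => hi (h1.trans h'.symm)
    exact key i h1 h0' hs' u u'

lemma expect_linForm_mul {s s' : Fin k → ZMod 2} (hs : s ≠ 0) (hs' : s' ≠ 0) (h : s ≠ s')
    (F G : Cube n → ℝ) :
    𝔼 y, F (linForm s y) * G (linForm s' y) = (𝔼 x, F x) * 𝔼 x, G x := by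
  let φ : (Fin k → Cube n) →+ Cube n × Cube n :=
    { toFun := fun y => (linForm s y, linForm s' y)
      map_zero' := by simp [linForm]
      map_add' := fun y y' => by simp [linForm_add] }
  have hφ : Function.Surjective φ := fun p => by
    obtain ⟨y, h1, h2⟩ := linForm_pair_surjective hs hs' h p.1 p.2
    exact ⟨y, Prod.ext h1 h2⟩
  have := expect_comp_of_surjective φ hφ fun p => F p.1 * G p.2
  refine this.trans ?_
  rw [← Finset.univ_product_univ, Finset.expect_product' _ _ fun x x' => F x * G x',
    Finset.expect_mul_expect]

lemma expect_linForm {s : Fin k → ZMod 2} (hs : s ≠ 0) (F : Cube n → ℝ) :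
    𝔼 y, F (linForm s y) = 𝔼 x, F x := by
  obtain ⟨i, hi⟩ := Function.ne_iff.1 hs
  have hi1 : s i = 1 := (zmod_two_cases _).resolve_left hi
  let φ : (Fin k → Cube n) →+ Cube n :=
    { toFun := fun y => linForm s y
      map_zero' := by simp [linForm]
      map_add' := linForm_add s }
  refine expect_comp_of_surjective φ (fun x => ⟨Pi.single i x, ?_⟩) F
  change linForm s _ = x
  rw [linForm_single, hi1, one_smul]

/-! ### Replacing independent coordinates by linearly dependent ones -/

/-- The expectation of `∏ₐ h a (pₐ)`, where the coordinates in `A` of the points `pₐ` are given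
by the linear forms `S a` in `k` common uniform points, and all other coordinates are uniform and
independent. -/
noncomputable def linExpect (S : Fin m → Fin k → ZMod 2) (h : Fin m → Cube n → ℝ)
    (A : Finset (Fin n)) : ℝ :=
  𝔼 y : Fin k → Cube n, ∏ a, avgOff A (h a) (linForm (S a) y)

lemma linExpect_empty (S : Fin m → Fin k → ZMod 2) (h : Fin m → Cube n → ℝ) :
    linExpect S h ∅ = ∏ a, 𝔼 x, h a x := by
  simp only [linExpect, avgOff_empty]
  exact Fintype.expect_const _

/-- The terms obtained by expanding the product `∏ₐ (avgOff A (h a) + reveal A j (h a))`. -/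
noncomputable def revealTerm (S : Fin m → Fin k → ZMod 2) (h : Fin m → Cube n → ℝ)
    (A : Finset (Fin n)) (j : Fin n) (T : Finset (Fin m)) (y : Fin k → Cube n) : ℝ :=
  (∏ a ∈ T, reveal A j (h a) (linForm (S a) y)) * ∏ a ∈ Tᶜ, avgOff A (h a) (linForm (S a) y)

lemma linExpect_insert_sub (S : Fin m → Fin k → ZMod 2) (h : Fin m → Cube n → ℝ)
    (A : Finset (Fin n)) (j : Fin n) :
    linExpect S h (insert j A) - linExpect S h A =
      ∑ T with T ≠ ∅, 𝔼 y, revealTerm S h A j T y := by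
  have h1 : ∀ y : Fin k → Cube n, ∏ a, avgOff (insert j A) (h a) (linForm (S a) y)
      = ∑ T, revealTerm S h A j T y := by
    intro y
    simp only [revealTerm, ← Fintype.prod_add]
    exact Finset.prod_congr rfl fun a _ => by rw [reveal]; ring
  simp only [linExpect, h1]
  rw [Finset.expect_sum_comm, sub_eq_iff_eq_add,
    ← Finset.sum_filter_add_sum_filter_not Finset.univ (fun T : Finset (Fin m) => T ≠ ∅)]
  congr 1
  simp [Finset.filter_eq', revealTerm]

/-- Translating the `j`-th coordinate of the common points changes the sign of a term unless the
linear forms indexed by `T` sum to zero. -/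
lemma expect_revealTerm_eq_zero {S : Fin m → Fin k → ZMod 2} {T : Finset (Fin m)}
    (hT : ∑ a ∈ T, S a ≠ 0) (h : Fin m → Cube n → ℝ) {A : Finset (Fin n)} {j : Fin n}
    (hj : j ∉ A) : 𝔼 y, revealTerm S h A j T y = 0 := by
  obtain ⟨i, hi⟩ := Function.ne_iff.1 hT
  have hi1 : ∑ a ∈ T, S a i = 1 := by
    rw [← Finset.sum_apply]
    exact (zmod_two_cases _).resolve_left hi
  have hshift : ∀ s : Fin k → ZMod 2, ∀ y : Fin k → Cube n,
      linForm s (y + Pi.single i (Pi.single j 1)) = linForm s y + Pi.single j (s i) := by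
    intro s y
    rw [linForm_add, linForm_single, ← Pi.single_smul, smul_eq_mul, mul_one]
  have h1 : ∀ y, revealTerm S h A j T (y + Pi.single i (Pi.single j 1))
      = - revealTerm S h A j T y := by
    intro y
    simp only [revealTerm, hshift, reveal_add_single hj, avgOff_add_single hj,
      Finset.prod_mul_distrib, ← neg_one_pow_val_sum, hi1, ZMod.val_one]
    ring
  have h2 := expect_add_right (revealTerm S h A j T) (Pi.single i (Pi.single j 1))
  simp only [h1, Finset.expect_neg_distrib] at h2
  linarith

/-- Distinct nonzero vectors have no linear relation of length one or two modulo two; this is the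
pairwise independence of the linear forms. -/
lemma two_lt_card_of_sum_eq_zero {S : Fin m → Fin k → ZMod 2} (hS0 : ∀ a, S a ≠ 0)
    (hS : Function.Injective S) {T : Finset (Fin m)} (hT : T ≠ ∅) (h : ∑ a ∈ T, S a = 0) :
    2 < T.card := by
  by_contra hcard
  have hpos := Finset.card_pos.2 (Finset.nonempty_iff_ne_empty.2 hT)
  obtain h1 | h2 : T.card = 1 ∨ T.card = 2 := by omega
  · obtain ⟨a, rfl⟩ := Finset.card_eq_one.1 h1
    exact hS0 a (by simpa using h)
  · obtain ⟨a, b, hab, rfl⟩ := Finset.card_eq_two.1 h2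
    rw [Finset.sum_pair hab, cube_add_eq_zero_iff] at h
    exact hab (hS h)

/-- A bound for the effect of revealing coordinate `j` that is additive in the influences; `r` is
the weight in the inequality of arithmetic and geometric means. -/
noncomputable def revealBound (r τ : ℝ) (w : ℕ) (h : Fin m → Cube n → ℝ) (A : Finset (Fin n))
    (j : Fin n) : ℝ :=
  (r⁻¹ * (τ * ∑ a, influenceIn A j (h a) + ∑ a, highInfluenceIn w A j (h a))
    + r * ∑ a, influenceIn A j (h a)) / 2

lemma revealBound_nonneg {r τ : ℝ} (hr : 0 < r) (hτ : 0 ≤ τ) (w : ℕ) (h : Fin m → Cube n → ℝ)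
    (A : Finset (Fin n)) (j : Fin n) : 0 ≤ revealBound r τ w h A j := by
  have h1 := Finset.sum_nonneg fun a (_ : a ∈ Finset.univ) => influenceIn_nonneg A j (h a)
  have h2 := Finset.sum_nonneg fun a (_ : a ∈ Finset.univ) => highInfluenceIn_nonneg w A j (h a)
  unfold revealBound
  positivity

lemma revealBound_mono {r τ : ℝ} (hr : 0 < r) (hτ : 0 ≤ τ) (w : ℕ) (h : Fin m → Cube n → ℝ)
    {A B : Finset (Fin n)} (hAB : A ⊆ B) (j : Fin n) :
    revealBound r τ w h A j ≤ revealBound r τ w h B j := by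
  have h1 := Finset.sum_le_sum fun a (_ : a ∈ Finset.univ) => influenceIn_mono hAB j (h a)
  have h2 := Finset.sum_le_sum fun a (_ : a ∈ Finset.univ) => highInfluenceIn_mono w hAB j (h a)
  unfold revealBound
  gcongr

/-- Terms with three revealed factors are small when two of the functions share no influential
variable: pairwise independence splits the second moment of two revealed factors. -/
lemma abs_expect_revealTerm_le {S : Fin m → Fin k → ZMod 2} (hS0 : ∀ a, S a ≠ 0)
    (hS : Function.Injective S) {h : Fin m → Cube n → ℝ} (h0 : ∀ a x, 0 ≤ h a x)
    (h1 : ∀ a x, h a x ≤ 1) {r τ : ℝ} (hr : 0 < r) (hτ : 0 ≤ τ) (w : ℕ) {A : Finset (Fin n)}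
    {j : Fin n} (hj : j ∉ A) {T : Finset (Fin m)} {a b c : Fin m} (ha : a ∈ T) (hb : b ∈ T)
    (hc : c ∈ T) (hab : a ≠ b) (hac : a ≠ c) (hbc : b ≠ c)
    (hlow : lowDegreeInfluence w j (h a) ≤ τ) :
    |𝔼 y, revealTerm S h A j T y| ≤ revealBound r τ w h (insert j A) j := by
  have habs : ∀ a x, |h a x| ≤ 1 := fun a x => abs_le.2 ⟨by linarith [h0 a x], h1 a x⟩
  have hpt : ∀ y, |revealTerm S h A j T y| ≤
      (r⁻¹ * (reveal A j (h a) (linForm (S a) y) ^ 2 * reveal A j (h b) (linForm (S b) y) ^ 2)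
        + r * reveal A j (h c) (linForm (S c) y) ^ 2) / 2 := by
    intro y
    set d : Fin m → ℝ := fun a => |reveal A j (h a) (linForm (S a) y)| with hd
    have hd0 : ∀ a, 0 ≤ d a := fun a => abs_nonneg _
    have hd1 : ∀ a, d a ≤ 1 := fun a => abs_reveal_le_one (h0 a) (h1 a) _ _ _
    have hsplit : ∏ a ∈ T, d a ≤ d a * d b * d c := by
      have hb' : b ∈ T.erase a := Finset.mem_erase.2 ⟨hab.symm, hb⟩
      have hc' : c ∈ (T.erase a).erase b :=
        Finset.mem_erase.2 ⟨hbc.symm, Finset.mem_erase.2 ⟨hac.symm, hc⟩⟩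
      rw [← Finset.mul_prod_erase T d ha, ← Finset.mul_prod_erase _ d hb',
        ← Finset.mul_prod_erase _ d hc', ← mul_assoc, ← mul_assoc]
      exact mul_le_of_le_one_right (mul_nonneg (mul_nonneg (hd0 a) (hd0 b)) (hd0 c))
        (Finset.prod_le_one (fun _ _ => hd0 _) fun _ _ => hd1 _)
    have hrest : |∏ a ∈ Tᶜ, avgOff A (h a) (linForm (S a) y)| ≤ 1 := by
      rw [abs_of_nonneg (Finset.prod_nonneg fun a _ => avgOff_nonneg (h0 a) _ _)]
      exact Finset.prod_le_one (fun a _ => avgOff_nonneg (h0 a) _ _)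
        fun a _ => avgOff_le_one (h1 a) _ _
    have hmain : |revealTerm S h A j T y| ≤ d a * d b * d c := by
      rw [revealTerm, abs_mul, Finset.abs_prod]
      exact (mul_le_of_le_one_right (Finset.prod_nonneg fun a _ => hd0 a) hrest).trans hsplit
    refine hmain.trans ?_
    rw [← sq_abs (reveal A j (h a) _), ← sq_abs (reveal A j (h b) _),
      ← sq_abs (reveal A j (h c) _)]
    change d a * d b * d c ≤ (r⁻¹ * (d a ^ 2 * d b ^ 2) + r * d c ^ 2) / 2
    -- The geometric mean of `r⁻¹ (d a · d b)²` and `r (d c)²` is `d a · d b · d c`.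
    have hsq : 0 ≤ r⁻¹ * (d a * d b - r * d c) ^ 2 := by positivity
    have hexp : r⁻¹ * (d a * d b - r * d c) ^ 2
        = r⁻¹ * (d a ^ 2 * d b ^ 2) + r * d c ^ 2 - 2 * (d a * d b * d c) := by
      field_simp
      ring
    linarith
  have hexp : |𝔼 y, revealTerm S h A j T y| ≤
      (r⁻¹ * (influenceIn (insert j A) j (h a) * influenceIn (insert j A) j (h b))
        + r * influenceIn (insert j A) j (h c)) / 2 := by
    refine (Finset.abs_expect_le _ _).trans
      ((Finset.expect_le_expect fun y _ => hpt y).trans_eq ?_)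
    rw [← Finset.expect_div, Finset.expect_add_distrib, ← Finset.mul_expect, ← Finset.mul_expect,
      expect_linForm_mul (hS0 a) (hS0 b) (hS.ne hab) (fun x => reveal A j (h a) x ^ 2)
        (fun x => reveal A j (h b) x ^ 2),
      expect_linForm (hS0 c) (fun x => reveal A j (h c) x ^ 2), expect_reveal_sq hj,
      expect_reveal_sq hj, expect_reveal_sq hj]
  refine hexp.trans ?_
  have hI := fun a => influenceIn_nonneg (insert j A) j (h a)
  have hH := fun a => highInfluenceIn_nonneg w (insert j A) j (h a)
  have hsI : ∀ a, influenceIn (insert j A) j (h a) ≤ ∑ a, influenceIn (insert j A) j (h a) :=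
    fun a => Finset.single_le_sum (f := fun a => influenceIn (insert j A) j (h a))
      (fun a _ => hI a) (Finset.mem_univ a)
  have hsH : ∀ a, highInfluenceIn w (insert j A) j (h a) ≤
      ∑ a, highInfluenceIn w (insert j A) j (h a) :=
    fun a => Finset.single_le_sum (f := fun a => highInfluenceIn w (insert j A) j (h a))
      (fun a _ => hH a) (Finset.mem_univ a)
  have hprod : influenceIn (insert j A) j (h a) * influenceIn (insert j A) j (h b) ≤
      τ * ∑ a, influenceIn (insert j A) j (h a) + ∑ a, highInfluenceIn w (insert j A) j (h a) := by
    calc _ ≤ (τ + highInfluenceIn w (insert j A) j (h a)) * influenceIn (insert j A) j (h b) :=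
          mul_le_mul_of_nonneg_right
            ((influenceIn_le w _ _ _).trans (add_le_add_left hlow _)) (hI b)
      _ = τ * influenceIn (insert j A) j (h b) +
            highInfluenceIn w (insert j A) j (h a) * influenceIn (insert j A) j (h b) := by ring
      _ ≤ _ := add_le_add (mul_le_mul_of_nonneg_left (hsI b) hτ)
          ((mul_le_of_le_one_right (hH a) (influenceIn_le_one (habs b) _ _)).trans (hsH a))
  unfold revealBound
  have := hsI c
  gcongr

/-- Every coordinate has low-degree influence at most `τ` on all but at most one of the functions. -/
def NoCommonInfluence (w : ℕ) (τ : ℝ) (h : Fin m → Cube n → ℝ) : Prop :=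
  ∀ j a b, a ≠ b → lowDegreeInfluence w j (h a) ≤ τ ∨ lowDegreeInfluence w j (h b) ≤ τ

lemma abs_linExpect_insert_sub_le {S : Fin m → Fin k → ZMod 2} (hS0 : ∀ a, S a ≠ 0)
    (hS : Function.Injective S) {h : Fin m → Cube n → ℝ} (h0 : ∀ a x, 0 ≤ h a x)
    (h1 : ∀ a x, h a x ≤ 1) {r τ : ℝ} (hr : 0 < r) (hτ : 0 ≤ τ) {w : ℕ}
    (hno : NoCommonInfluence w τ h) {A : Finset (Fin n)} {j : Fin n} (hj : j ∉ A) :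
    |linExpect S h (insert j A) - linExpect S h A| ≤
      2 ^ m * revealBound r τ w h (insert j A) j := by
  have hB := revealBound_nonneg hr hτ w h (insert j A) j
  have hterm : ∀ T : Finset (Fin m), T ≠ ∅ →
      |𝔼 y, revealTerm S h A j T y| ≤ revealBound r τ w h (insert j A) j := by
    intro T hT
    by_cases hsum : ∑ a ∈ T, S a = 0
    · obtain ⟨a, ha, b, hb, c, hc, hab, hac, hbc⟩ :=
        Finset.two_lt_card.1 (two_lt_card_of_sum_eq_zero hS0 hS hT hsum)
      rcases hno j a b hab with hlow | hlow
      · exact abs_expect_revealTerm_le hS0 hS h0 h1 hr hτ w hj ha hb hc hab hac hbc hlow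
      · exact abs_expect_revealTerm_le hS0 hS h0 h1 hr hτ w hj hb ha hc hab.symm hbc hac hlow
    · rw [expect_revealTerm_eq_zero hsum h hj, abs_zero]
      exact hB
  rw [linExpect_insert_sub]
  calc _ ≤ ∑ T : Finset (Fin m) with T ≠ ∅, |𝔼 y, revealTerm S h A j T y| :=
        Finset.abs_sum_le_sum_abs _ _
    _ ≤ ∑ T : Finset (Fin m) with T ≠ ∅, revealBound r τ w h (insert j A) j :=
        Finset.sum_le_sum fun T hT => hterm T (Finset.mem_filter.1 hT).2
    _ ≤ ∑ _T : Finset (Fin m), revealBound r τ w h (insert j A) j :=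
        Finset.sum_le_sum_of_subset_of_nonneg (Finset.filter_subset _ _) fun _ _ _ => hB
    _ = 2 ^ m * revealBound r τ w h (insert j A) j := by simp

/-- The coordinates in `A` are exchanged one at a time; the bounds of the steps add up because
`revealBound` is monotone in the set. -/
lemma abs_linExpect_sub_le {S : Fin m → Fin k → ZMod 2} (hS0 : ∀ a, S a ≠ 0)
    (hS : Function.Injective S) {h : Fin m → Cube n → ℝ} (h0 : ∀ a x, 0 ≤ h a x)
    (h1 : ∀ a x, h a x ≤ 1) {r τ : ℝ} (hr : 0 < r) (hτ : 0 ≤ τ) {w : ℕ}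
    (hno : NoCommonInfluence w τ h) (A : Finset (Fin n)) :
    |linExpect S h A - ∏ a, 𝔼 x, h a x| ≤ 2 ^ m * ∑ j ∈ A, revealBound r τ w h A j := by
  induction A using Finset.induction_on with
  | empty => simp [linExpect_empty]
  | insert j A hj ih =>
    have hstep := abs_linExpect_insert_sub_le hS0 hS h0 h1 hr hτ hno hj
    have hmono : ∑ i ∈ A, revealBound r τ w h A i ≤ ∑ i ∈ A, revealBound r τ w h (insert j A) i :=
      Finset.sum_le_sum fun i _ => revealBound_mono hr hτ w h (Finset.subset_insert _ _) i
    have hmono' := mul_le_mul_of_nonneg_left hmono (show (0 : ℝ) ≤ 2 ^ m by positivity)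
    have htri := abs_sub_le (linExpect S h (insert j A)) (linExpect S h A) (∏ a, 𝔼 x, h a x)
    rw [Finset.sum_insert hj, mul_add]
    linarith


/-! ### Random sets of coordinates -/

/-- The coordinates whose dictators take the value `b` at `x`. For uniform `x` this is a uniformly
random set of coordinates, whatever `b` is. -/
def agreeSet (b : ℤˣ) (x : Cube n) : Finset (Fin n) := {j | dictator j x = b}

lemma mem_agreeSet {b : ℤˣ} {x : Cube n} {j : Fin n} : j ∈ agreeSet b x ↔ dictator j x = b := by
  simp [agreeSet]

lemma expect_mem_supportedIn_agreeSet (b : ℤˣ) (α : Cube n) :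
    (𝔼 x, if α ∈ supportedIn (agreeSet b x) then (1 : ℝ) else 0) = (1 / 2) ^ weight α := by
  have h1 : ∀ x : Cube n, (if α ∈ supportedIn (agreeSet b x) then (1 : ℝ) else 0)
      = ∏ i, if (-1 : ℤˣ) ^ (x i).val ≠ b → α i = 0 then 1 else 0 := by
    intro x
    rw [Finset.prod_boole]
    simp [mem_supportedIn, mem_agreeSet, dictator]
  simp only [h1]
  rw [expect_prod_pi fun i (c : ZMod 2) => if (-1 : ℤˣ) ^ c.val ≠ b → α i = 0 then (1 : ℝ) else 0,
    weight, ← Finset.prod_pow_eq_pow_sum]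
  refine Finset.prod_congr rfl fun i _ => ?_
  have h2 : (1 : ℤˣ) ≠ -1 := by decide
  rcases zmod_two_cases (α i) with hα | hα <;> rcases Int.units_eq_one_or b with rfl | rfl <;>
    simp [expect_zmod_two, hα, ZMod.val_one, h2, h2.symm]

lemma sum_sum_supportedIn (A : Finset (Fin n)) (p : Cube n → Prop) [DecidablePred p]
    (c : Cube n → ℝ) :
    ∑ j ∈ A, ∑ α ∈ supportedIn A with α j = 1 ∧ p α, c α =
      ∑ α, if p α then weight α * c α * (if α ∈ supportedIn A then 1 else 0) else 0 := by
  have h1 : ∀ j, ∑ α ∈ supportedIn A with α j = 1 ∧ p α, c α =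
      ∑ α, if α ∈ supportedIn A ∧ α j = 1 ∧ p α then c α else 0 := by
    intro j
    rw [← Finset.sum_filter]
    exact Finset.sum_congr (by ext; simp) fun _ _ => rfl
  simp only [h1]
  rw [Finset.sum_comm]
  refine Finset.sum_congr rfl fun α _ => ?_
  by_cases hα : α ∈ supportedIn A
  · by_cases hp : p α
    · have h2 : (weight α : ℝ) = ∑ j ∈ A, if α j = 1 then 1 else 0 := by
        rw [weight, Nat.cast_sum, ← Finset.sum_subset (Finset.subset_univ A)
          fun j _ hj => by simp [mem_supportedIn.1 hα j hj]]
        refine Finset.sum_congr rfl fun j _ => ?_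
        rcases zmod_two_cases (α j) with h | h <;> simp [h, ZMod.val_one]
      simp only [hα, hp, h2, true_and, and_true, if_true, mul_one, Finset.sum_mul, ite_mul, one_mul,
        zero_mul]
    · simp [hp]
  · simp [hα]

lemma expect_sum_sum_supportedIn (b : ℤˣ) (p : Cube n → Prop) [DecidablePred p]
    (c : Cube n → ℝ) :
    𝔼 x, ∑ j ∈ agreeSet b x, ∑ α ∈ supportedIn (agreeSet b x) with α j = 1 ∧ p α, c α =
      ∑ α, if p α then weight α * (1 / 2) ^ weight α * c α else 0 := by
  simp only [sum_sum_supportedIn]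
  rw [Finset.expect_sum_comm]
  refine Finset.sum_congr rfl fun α _ => ?_
  split_ifs
  · rw [← Finset.mul_expect, expect_mem_supportedIn_agreeSet]
    ring
  · exact Fintype.expect_const _

lemma mul_half_pow_le_one (d : ℕ) : (d : ℝ) * (1 / 2) ^ d ≤ 1 := by
  rw [one_div, inv_pow, ← div_eq_mul_inv, div_le_one (by positivity)]
  exact_mod_cast Nat.lt_two_pow_self.le

lemma sq_le_two_mul_two_pow : ∀ d : ℕ, d ^ 2 ≤ 2 * 2 ^ d
  | 0 | 1 | 2 => by norm_num
  | d + 3 => by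
    induction d with
    | zero => norm_num
    | succ d ih =>
      rw [show d + 1 + 3 = d + 3 + 1 by ring, pow_succ 2]
      have : (d + 3 + 1) ^ 2 ≤ 2 * (d + 3) ^ 2 := by nlinarith [Nat.zero_le (d ^ 2), Nat.zero_le d]
      omega

lemma mul_half_pow_le {w d : ℕ} (hw : 0 < w) (h : w < d) : (d : ℝ) * (1 / 2) ^ d ≤ 2 / w := by
  have hd : (0 : ℝ) < d := by exact_mod_cast hw.trans h
  have h1 : (d : ℝ) ^ 2 ≤ 2 * 2 ^ d := by exact_mod_cast sq_le_two_mul_two_pow d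
  calc (d : ℝ) * (1 / 2) ^ d = d / 2 ^ d := by rw [one_div, inv_pow, div_eq_mul_inv]
    _ ≤ 2 / d := by
        rw [div_le_div_iff₀ (by positivity) hd]
        linarith
    _ ≤ 2 / w := by
        have : (w : ℝ) ≤ d := by exact_mod_cast h.le
        have : (0 : ℝ) < w := by exact_mod_cast hw
        gcongr

/-- A random half of the coordinates contains the support of a vector of weight `d` with probability
`2 ^ (-d)`, so the total influence is bounded after averaging over it, independently of `n`. -/
lemma expect_sum_influenceIn_le_one {f : Cube n → ℝ} (hf : ∀ x, |f x| ≤ 1) (b : ℤˣ) :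
    𝔼 x, ∑ j ∈ agreeSet b x, influenceIn (agreeSet b x) j f ≤ 1 := by
  have := expect_sum_sum_supportedIn b (fun _ => True) fun α => cubeFourierCoeff f α ^ 2
  simp only [and_true, if_true] at this
  simp only [influenceIn, this]
  refine le_trans (Finset.sum_le_sum fun α _ => ?_) (sum_sq_cubeFourierCoeff_le_one hf)
  exact mul_le_of_le_one_left (sq_nonneg _) (mul_half_pow_le_one _)

lemma expect_sum_highInfluenceIn_le {f : Cube n → ℝ} (hf : ∀ x, |f x| ≤ 1) (b : ℤˣ) {w : ℕ}
    (hw : 0 < w) :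
    𝔼 x, ∑ j ∈ agreeSet b x, highInfluenceIn w (agreeSet b x) j f ≤ 2 / w := by
  simp only [highInfluenceIn, expect_sum_sum_supportedIn b (fun α => w < weight α)
    fun α => cubeFourierCoeff f α ^ 2]
  calc _ ≤ ∑ α : Cube n, 2 / (w : ℝ) * cubeFourierCoeff f α ^ 2 := by
        refine Finset.sum_le_sum fun α _ => ?_
        split_ifs with h
        · exact mul_le_mul_of_nonneg_right (mul_half_pow_le hw h) (sq_nonneg _)
        · positivity
    _ ≤ 2 / (w : ℝ) := by
        rw [← Finset.mul_sum]
        exact mul_le_of_le_one_right (by positivity) (sum_sq_cubeFourierCoeff_le_one hf)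

/-- If no coordinate is influential for two functions, then on a random half of the coordinates
independent points may be replaced by pairwise independent linear forms. -/
lemma expect_linExpect_le {S : Fin m → Fin k → ZMod 2} (hS0 : ∀ a, S a ≠ 0)
    (hS : Function.Injective S) {h : Fin m → Cube n → ℝ} (h0 : ∀ a x, 0 ≤ h a x)
    (h1 : ∀ a x, h a x ≤ 1) {r τ : ℝ} (hr : 0 < r) (hτ : 0 ≤ τ) {w : ℕ} (hw : 0 < w)
    (hno : NoCommonInfluence w τ h) (b : ℤˣ) :
    𝔼 x, linExpect S h (agreeSet b x) ≤
      ∏ a, 𝔼 x, h a x + 2 ^ m * m * ((r⁻¹ * (τ + 2 / w) + r) / 2) := by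
  have habs : ∀ a x, |h a x| ≤ 1 := fun a x => abs_le.2 ⟨by linarith [h0 a x], h1 a x⟩
  have hI : 𝔼 x, ∑ j ∈ agreeSet b x, ∑ a, influenceIn (agreeSet b x) j (h a) ≤ m := by
    have : ∀ x, ∑ j ∈ agreeSet b x, ∑ a, influenceIn (agreeSet b x) j (h a)
        = ∑ a, ∑ j ∈ agreeSet b x, influenceIn (agreeSet b x) j (h a) :=
      fun x => Finset.sum_comm
    simp only [this]
    rw [Finset.expect_sum_comm]
    exact (Finset.sum_le_sum fun a _ => expect_sum_influenceIn_le_one (habs a) b).trans_eq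
      (by simp)
  have hH : 𝔼 x, ∑ j ∈ agreeSet b x, ∑ a, highInfluenceIn w (agreeSet b x) j (h a)
      ≤ m * (2 / w) := by
    have : ∀ x, ∑ j ∈ agreeSet b x, ∑ a, highInfluenceIn w (agreeSet b x) j (h a)
        = ∑ a, ∑ j ∈ agreeSet b x, highInfluenceIn w (agreeSet b x) j (h a) :=
      fun x => Finset.sum_comm
    simp only [this]
    rw [Finset.expect_sum_comm]
    exact (Finset.sum_le_sum fun a _ => expect_sum_highInfluenceIn_le (habs a) b hw).trans_eq
      (by simp)
  have hpt : ∀ x, linExpect S h (agreeSet b x) ≤ ∏ a, 𝔼 x, h a x +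
      2 ^ m * ∑ j ∈ agreeSet b x, revealBound r τ w h (agreeSet b x) j := fun x => by
    linarith [(abs_le.1 (abs_linExpect_sub_le hS0 hS h0 h1 hr hτ hno (agreeSet b x))).2]
  refine (Finset.expect_le_expect fun x _ => hpt x).trans ?_
  simp only [revealBound, ← Finset.sum_div, Finset.sum_add_distrib, ← Finset.mul_sum]
  rw [Finset.expect_add_distrib, Fintype.expect_const, ← Finset.mul_expect, ← Finset.expect_div,
    Finset.expect_add_distrib, ← Finset.mul_expect, Finset.expect_add_distrib,
    ← Finset.mul_expect, ← Finset.mul_expect, mul_assoc]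
  gcongr
  have hr' : 0 ≤ r⁻¹ := (inv_pos.2 hr).le
  calc _ ≤ (r⁻¹ * (τ * m + m * (2 / w)) + r * m) / 2 := by gcongr
    _ = _ := by ring

/-! ### The test -/

variable {t : ℕ}

/-- Query all of the given points and continue depending on the answers. -/
def QueryTree.batch {r : ℕ} : (l : ℕ) → (Fin l → Fin t × Cube n) →
    ((Fin l → ℤˣ) → QueryTree t n r) → QueryTree t n (r + l)
  | 0, _, next => next Fin.elim0
  | l + 1, p, next => .query (p 0).1 (p 0).2 fun b =>
      QueryTree.batch l (fun i => p i.succ) fun bs => next (Fin.cons b bs)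

lemma QueryTree.run_batch {r : ℕ} (f : Fin t → BoolFun n) : ∀ (l : ℕ)
    (p : Fin l → Fin t × Cube n) (next : (Fin l → ℤˣ) → QueryTree t n r),
    (QueryTree.batch l p next).run f = (next fun i => f (p i).1 (p i).2).run f
  | 0, p, next => by
    rw [QueryTree.batch]
    congr 2
    exact Subsingleton.elim _ _
  | l + 1, p, next => by
    rw [QueryTree.batch, QueryTree.run, QueryTree.run_batch f l]
    congr 2
    ext i
    cases i using Fin.cases <;> rfl

/-- The sign that the answers `b` predict for the linear form with coefficient vector `s`. -/
def predictedSign (s : Fin k → ZMod 2) (b : Fin k → ℤˣ) : ℤˣ := ∏ i, b i ^ (s i).val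

/-- The test queries `f a₀` at the points `x` and `y₁, …, y_k`, and then each `f (ι a)` at the point
that agrees with the linear form `S a` in the `yᵢ` on the coordinates whose dictators explain the
answer at `x`, and that is uniformly random elsewhere. It accepts if all values of the latter kind
are those predicted by the answers at `y₁, …, y_k`. -/
def linearFormTester (a₀ : Fin t) (ι : Fin m → Fin t) (S : Fin m → Fin k → ZMod 2) (n : ℕ) :
    Tester t n (0 + m + k + 1) where
  Coins := Cube n × (Fin k → Cube n) × (Fin m → Cube n)
  strategy c := .query a₀ c.1 fun b₀ => .batch k (fun i => (a₀, c.2.1 i)) fun b =>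
    .batch m (fun a => (ι a, mix (agreeSet b₀ c.1) (linForm (S a) c.2.1) (c.2.2 a))) fun v =>
      .decide (decide (∀ a, v a = predictedSign (S a) b))

lemma linearFormTester_run (a₀ : Fin t) (ι : Fin m → Fin t) (S : Fin m → Fin k → ZMod 2)
    (f : Fin t → BoolFun n) (x : Cube n) (y : Fin k → Cube n) (z : Fin m → Cube n) :
    ((linearFormTester a₀ ι S n).strategy (x, y, z)).run f = true ↔
      ∀ a, f (ι a) (mix (agreeSet (f a₀ x) x) (linForm (S a) y) (z a)) =
        predictedSign (S a) fun i => f a₀ (y i) := by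
  simp [linearFormTester, QueryTree.run, QueryTree.run_batch]

lemma acceptProb_linearFormTester (a₀ : Fin t) (ι : Fin m → Fin t) (S : Fin m → Fin k → ZMod 2)
    (f : Fin t → BoolFun n) :
    (linearFormTester a₀ ι S n).acceptProb f = 𝔼 x, 𝔼 y, 𝔼 z : Fin m → Cube n,
      if ∀ a, f (ι a) (mix (agreeSet (f a₀ x) x) (linForm (S a) y) (z a)) =
        predictedSign (S a) fun i => f a₀ (y i) then (1 : ℝ) else 0 := by
  have h1 : (linearFormTester a₀ ι S n).acceptProb f =
      𝔼 c : Cube n × (Fin k → Cube n) × (Fin m → Cube n),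
        if ((linearFormTester a₀ ι S n).strategy c).run f = true then (1 : ℝ) else 0 := by
    rw [Fintype.expect_eq_sum_div_card, Finset.sum_boole]
    rfl
  rw [h1, ← Finset.univ_product_univ, Finset.expect_product]
  refine Finset.expect_congr rfl fun x _ => ?_
  rw [← Finset.univ_product_univ, Finset.expect_product]
  simp only [linearFormTester_run]

/-- On the coordinates of `agreeSet` the queried points are linear forms in the `yᵢ`, so a
dictator passes every check. -/
lemma acceptProb_dictator (a₀ : Fin t) (ι : Fin m → Fin t) (S : Fin m → Fin k → ZMod 2)
    {f : Fin t → BoolFun n} {j : Fin n} (hf : ∀ a, f a = dictator j) :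
    (linearFormTester a₀ ι S n).acceptProb f = 1 := by
  rw [acceptProb_linearFormTester]
  have h1 : ∀ x y (z : Fin m → Cube n), ∀ a, f (ι a) (mix (agreeSet (f a₀ x) x) (linForm (S a) y) (z a)) =
      predictedSign (S a) fun i => f a₀ (y i) := by
    intro x y z a
    have hj : j ∈ agreeSet (dictator j x) x := mem_agreeSet.2 rfl
    have hmix : mix (agreeSet (dictator j x) x) (linForm (S a) y) (z a) j = linForm (S a) y j :=
      if_pos hj
    simp only [hf]
    rw [dictator, hmix, linForm_apply, neg_one_pow_val_sum, predictedSign]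
    simp only [dictator]
    refine Finset.prod_congr rfl fun i _ => ?_
    rcases zmod_two_cases (S a i) with h | h <;> simp [h, ZMod.val_one]
  simp only [h1, implies_true, if_true, Fintype.expect_const]

/-! ### Soundness -/

/-- The indicator of `f x = σ`. -/
def indicatorEq (σ : ℤˣ) (f : BoolFun n) (x : Cube n) : ℝ := if f x = σ then 1 else 0

lemma indicatorEq_nonneg (σ : ℤˣ) (f : BoolFun n) (x : Cube n) : 0 ≤ indicatorEq σ f x := by
  unfold indicatorEq
  split_ifs <;> norm_num

lemma indicatorEq_le_one (σ : ℤˣ) (f : BoolFun n) (x : Cube n) : indicatorEq σ f x ≤ 1 := by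
  unfold indicatorEq
  split_ifs <;> norm_num

lemma indicatorEq_eq (σ : ℤˣ) (f : BoolFun n) (x : Cube n) :
    indicatorEq σ f x = 1 / 2 + ((σ : ℤ) : ℝ) / 2 * f.toReal x := by
  have h : (1 : ℤˣ) ≠ -1 := by decide
  unfold indicatorEq BoolFun.toReal
  rcases Int.units_eq_one_or σ with rfl | rfl <;> rcases Int.units_eq_one_or (f x) with hx | hx <;>
    norm_num [hx, h, h.symm]

lemma expect_toReal_of_folded {f : BoolFun n} (hf : Folded f) : 𝔼 x, f.toReal x = 0 := by
  have h1 := expect_add_right f.toReal 1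
  have h2 : ∀ x, f.toReal (x + 1) = - f.toReal x := fun x => by
    rw [add_comm, BoolFun.toReal, hf, BoolFun.toReal, Units.val_neg, Int.cast_neg]
  simp only [h2, Finset.expect_neg_distrib] at h1
  linarith

lemma expect_indicatorEq_of_folded {f : BoolFun n} (hf : Folded f) (σ : ℤˣ) :
    𝔼 x, indicatorEq σ f x = 1 / 2 := by
  simp only [indicatorEq_eq, Finset.expect_add_distrib, ← Finset.mul_expect,
    expect_toReal_of_folded hf, Fintype.expect_const, mul_zero, add_zero]

/-- Up to a sign, the indicator is `f / 2` plus a constant, and the constant changes only the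
coefficient at `0`, which does not enter an influence. -/
lemma lowDegreeInfluence_indicatorEq_le (w : ℕ) (j : Fin n) (σ : ℤˣ) (f : BoolFun n) :
    lowDegreeInfluence w j (indicatorEq σ f) ≤ lowDegreeInfluence w j f.toReal := by
  refine Finset.sum_le_sum fun α hα => ?_
  have hα0 : α ≠ 0 := by
    rintro rfl
    simp at hα
  have h1 : cubeFourierCoeff (indicatorEq σ f) α =
      ((σ : ℤ) : ℝ) / 2 * cubeFourierCoeff f.toReal α := by
    simp only [cubeFourierCoeff, indicatorEq_eq, add_mul, Finset.expect_add_distrib,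
      mul_assoc, ← Finset.mul_expect, expect_character, if_neg hα0]
    ring
  have h2 : ((σ : ℤ) : ℝ) ^ 2 = 1 := by rcases Int.units_eq_one_or σ with rfl | rfl <;> norm_num
  rw [h1, mul_pow, div_pow, h2]
  nlinarith [sq_nonneg (cubeFourierCoeff f.toReal α)]

/-- The union bound over the answers to the first `k + 1` queries: once these answers are fixed,
the remaining queries are no longer adaptive. -/
lemma acceptProb_le_sum (a₀ : Fin t) (ι : Fin m → Fin t) (S : Fin m → Fin k → ZMod 2)
    (f : Fin t → BoolFun n) :
    (linearFormTester a₀ ι S n).acceptProb f ≤ ∑ b₀ : ℤˣ, ∑ b : Fin k → ℤˣ,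
      𝔼 x, linExpect S (fun a => indicatorEq (predictedSign (S a) b) (f (ι a)))
        (agreeSet b₀ x) := by
  set h : (Fin k → ℤˣ) → Fin m → Cube n → ℝ :=
    fun b a => indicatorEq (predictedSign (S a) b) (f (ι a)) with hh
  have hlin : ∀ b A, linExpect S (h b) A =
      𝔼 y, 𝔼 z : Fin m → Cube n, ∏ a, h b a (mix A (linForm (S a) y) (z a)) := fun b A => by
    refine Finset.expect_congr rfl fun y _ => ?_
    rw [expect_prod_pi fun a (z : Cube n) => h b a (mix A (linForm (S a) y) z)]
    rfl
  change _ ≤ ∑ b₀ : ℤˣ, ∑ b, 𝔼 x, linExpect S (h b) (agreeSet b₀ x)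
  simp only [hlin, acceptProb_linearFormTester]
  simp only [← Finset.expect_sum_comm]
  refine Finset.expect_le_expect fun x _ => Finset.expect_le_expect fun y _ =>
    Finset.expect_le_expect fun z _ => ?_
  have hpos : ∀ (b₀ : ℤˣ) b, 0 ≤ ∏ a, h b a (mix (agreeSet b₀ x) (linForm (S a) y) (z a)) :=
    fun b₀ b => Finset.prod_nonneg fun a _ => indicatorEq_nonneg _ _ _
  refine le_trans (le_of_eq ?_) ((Finset.single_le_sum
    (f := fun b => ∏ a, h b a (mix (agreeSet (f a₀ x) x) (linForm (S a) y) (z a)))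
    (fun b _ => hpos _ b) (Finset.mem_univ fun i => f a₀ (y i))).trans
    (Finset.single_le_sum (f := fun b₀ => ∑ b, ∏ a, h b a
      (mix (agreeSet b₀ x) (linForm (S a) y) (z a)))
      (fun b₀ _ => Finset.sum_nonneg fun b _ => hpos b₀ b) (Finset.mem_univ (f a₀ x))))
  simp only [hh, indicatorEq, Finset.prod_boole, Finset.mem_univ, forall_const]

lemma acceptProb_le {a₀ : Fin t} {ι : Fin m → Fin t} (hι : Function.Injective ι)
    {S : Fin m → Fin k → ZMod 2} (hS0 : ∀ a, S a ≠ 0) (hS : Function.Injective S)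
    {f : Fin t → BoolFun n} (hf : ∀ a, Folded (f a)) {r τ : ℝ} (hr : 0 < r) (hτ : 0 ≤ τ) {w : ℕ}
    (hw : 0 < w) (hno : NoCommonInfluence w τ fun a => (f a).toReal) :
    (linearFormTester a₀ ι S n).acceptProb f ≤
      2 ^ (k + 1) * ((1 / 2) ^ m + 2 ^ m * m * ((r⁻¹ * (τ + 2 / w) + r) / 2)) := by
  refine (acceptProb_le_sum a₀ ι S f).trans ?_
  have hterm : ∀ (b₀ : ℤˣ) (b : Fin k → ℤˣ),
      𝔼 x, linExpect S (fun a => indicatorEq (predictedSign (S a) b) (f (ι a))) (agreeSet b₀ x) ≤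
        (1 / 2) ^ m + 2 ^ m * m * ((r⁻¹ * (τ + 2 / w) + r) / 2) := by
    intro b₀ b
    refine (expect_linExpect_le hS0 hS (fun a => indicatorEq_nonneg _ _)
      (fun a => indicatorEq_le_one _ _) hr hτ hw (fun j a a' haa' => ?_) b₀).trans_eq ?_
    · exact (hno j (ι a) (ι a') (hι.ne haa')).imp
        (lowDegreeInfluence_indicatorEq_le _ _ _ _).trans
        (lowDegreeInfluence_indicatorEq_le _ _ _ _).trans
    · simp [expect_indicatorEq_of_folded (hf _)]
  refine (Finset.sum_le_sum fun b₀ _ => Finset.sum_le_sum fun b _ => hterm b₀ b).trans_eq ?_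
  simp only [Finset.sum_const, Finset.card_univ, Fintype.card_fun, Fintype.card_units_int,
    Fintype.card_fin, nsmul_eq_mul]
  push_cast
  ring

/-- The test built on `m` distinct nonzero linear forms in `k` variables has perfect completeness
and soundness `2 ^ (k + 1) / 2 ^ m`. -/
theorem hasDictatorshipTest_linearForms {q : ℕ} (ht : 0 < t) (hmt : m ≤ t) (hmk : m < 2 ^ k)
    (hq : q = m + k + 1) : HasDictatorshipTest t q 1 (2 ^ (k + 1) / 2 ^ m) := by
  obtain ⟨S, hS⟩ : ∃ S : Fin m → {s : Fin k → ZMod 2 // s ≠ 0}, Function.Injective S := by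
    have hcard : Fintype.card (Fin m) ≤ Fintype.card {s : Fin k → ZMod 2 // s ≠ 0} := by
      rw [Fintype.card_subtype_compl]
      simp
      omega
    exact (Function.Embedding.nonempty_of_card_le hcard).elim fun e => ⟨e, e.injective⟩
  have hS0 : ∀ a, (S a : Fin k → ZMod 2) ≠ 0 := fun a => (S a).2
  have hS' : Function.Injective fun a => (S a : Fin k → ZMod 2) :=
    Subtype.val_injective.comp hS
  obtain rfl : q = 0 + m + k + 1 := by omega
  refine ⟨linearFormTester ⟨0, ht⟩ (Fin.castLE hmt) fun a => S a, ?_, ?_⟩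
  · intro n f j hf
    exact (acceptProb_dictator _ _ _ hf).ge
  · intro ε hε
    -- The error term is at most `r` times a factor below `K`, hence at most `K * r = ε / 2`.
    set K : ℝ := 2 ^ (k + 1) * (2 ^ m * m) + 1 with hK
    have hK0 : 0 < K := by positivity
    set r : ℝ := ε / (2 * K) with hr
    have hr0 : 0 < r := by positivity
    obtain ⟨w, hw⟩ := exists_nat_gt (4 / r ^ 2)
    have hw0 : (0 : ℝ) < w := lt_trans (by positivity) hw
    have hw1 : 2 / (w : ℝ) ≤ r ^ 2 / 2 := by
      rw [div_lt_iff₀ (by positivity)] at hw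
      rw [div_le_div_iff₀ hw0 two_pos]
      linarith
    refine ⟨r ^ 2 / 2, by positivity, w, by exact_mod_cast hw0, fun n f hf hacc => ?_⟩
    by_contra hcon
    push Not at hcon
    have hno : NoCommonInfluence w (r ^ 2 / 2) fun a => (f a).toReal := fun j a b hab =>
      (le_total (r ^ 2 / 2) (lowDegreeInfluence w j (f a).toReal)).elim
        (fun h => Or.inr (hcon a b hab j h).le) Or.inl
    have hle := acceptProb_le (a₀ := ⟨0, ht⟩) (Fin.castLE_injective hmt) hS0 hS' hf hr0
      (by positivity) (by exact_mod_cast hw0) hno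
    have herr : (r⁻¹ * (r ^ 2 / 2 + 2 / w) + r) / 2 ≤ r := by
      have : r⁻¹ * (r ^ 2 / 2 + 2 / w) ≤ r⁻¹ * (r ^ 2) := by gcongr; linarith
      have h2 : r⁻¹ * r ^ 2 = r := by field_simp
      linarith
    have hfinal : 2 ^ (k + 1) * ((1 / 2) ^ m + 2 ^ m * m * ((r⁻¹ * (r ^ 2 / 2 + 2 / w) + r) / 2))
        ≤ (2 : ℝ) ^ (k + 1) / 2 ^ m + K * r := by
      calc _ ≤ (2 : ℝ) ^ (k + 1) * ((1 / 2) ^ m + 2 ^ m * m * r) := by gcongr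
        _ = (2 : ℝ) ^ (k + 1) / 2 ^ m + (K - 1) * r := by
            rw [hK, one_div, inv_pow]
            ring
        _ ≤ _ := by nlinarith
    have hKr : K * r = ε / 2 := by
      rw [hr]
      field_simp
    linarith


/-! ### Choice of parameters -/

lemma HasDictatorshipTest.mono {t q : ℕ} {c s s' : ℝ} (h : HasDictatorshipTest t q c s)
    (hs : s ≤ s') : HasDictatorshipTest t q c s' := by
  obtain ⟨T, hc, hT⟩ := h
  refine ⟨T, hc, fun ε hε => ?_⟩
  obtain ⟨τ, hτ, w, hw, hT⟩ := hT ε hε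
  exact ⟨τ, hτ, w, hw, fun n f hf hacc => hT n f hf (by linarith)⟩

/-- Acceptance probabilities are at most `1`, so soundness at least `1` is no condition. -/
lemma HasDictatorshipTest.of_one_le {t q : ℕ} {c s s' : ℝ} (h : HasDictatorshipTest t q c s)
    (hs : 1 ≤ s') : HasDictatorshipTest t q c s' := by
  obtain ⟨T, hc, -⟩ := h
  refine ⟨T, hc, fun ε hε => ⟨1, one_pos, 1, one_pos, fun n f _ hacc => ?_⟩⟩
  have : (T n).acceptProb f ≤ 1 := by
    refine div_le_one_of_le₀ ?_ (Nat.cast_nonneg _)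
    exact_mod_cast Finset.card_le_univ _
  linarith

lemma hasDictatorshipTest_two_pow {k t : ℕ} (hk : 1 ≤ k) (ht : t + 1 = 2 ^ k) :
    HasDictatorshipTest t (t + Nat.log 2 (t + 1)) 1 (((t : ℝ) + 1) ^ 2 / 2 ^ t) := by
  have hlog : Nat.log 2 (t + 1) = k := by rw [ht, Nat.log_pow one_lt_two]
  have hkpow : 2 ≤ 2 ^ k := by simpa using Nat.pow_le_pow_right two_pos hk
  -- One query beyond the `k` points `yᵢ` pays for the random set, so `t - 1` forms remain.
  obtain ⟨m, rfl⟩ : ∃ m, t = m + 1 := ⟨t - 1, by omega⟩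
  have htest : HasDictatorshipTest (m + 1) (m + 1 + k) 1 (2 ^ (k + 1) / 2 ^ m) :=
    hasDictatorshipTest_linearForms (by omega) (by omega) (by omega) (by omega)
  rw [hlog]
  have ht' : (((m + 1 : ℕ) : ℝ) + 1) = 2 ^ k := by exact_mod_cast ht
  rw [ht']
  obtain rfl | hk2 : k = 1 ∨ 2 ≤ k := by omega
  · obtain rfl : m = 0 := by omega
    exact htest.of_one_le (by norm_num)
  · refine htest.mono ?_
    rw [div_le_div_iff₀ (by positivity) (by positivity)]
    have h4 : (4 : ℝ) ≤ 2 ^ k := by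
      calc (4 : ℝ) = 2 ^ 2 := by norm_num
        _ ≤ 2 ^ k := pow_le_pow_right₀ one_le_two hk2
    calc (2 : ℝ) ^ (k + 1) * 2 ^ (m + 1) = 4 * (2 ^ k * 2 ^ m) := by ring
      _ ≤ 2 ^ k * (2 ^ k * 2 ^ m) := by gcongr
      _ = (2 ^ k) ^ 2 * 2 ^ m := by ring

/-- With `k = ⌊log₂ (q - 2)⌋ + 1` there are enough forms for `q - k - 1` checks. -/
lemma exists_hasDictatorshipTest {q : ℕ} (hq : 3 ≤ q) :
    ∃ t : ℕ, t ≤ q ∧ (q : ℝ) - 200 * Real.logb 2 q ≤ t ∧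
      HasDictatorshipTest t q 1 (16 * (q : ℝ) ^ 3 / 2 ^ q) := by
  obtain ⟨l, hl⟩ : ∃ l, l = Nat.log 2 (q - 2) := ⟨_, rfl⟩
  have hlow : 2 ^ l ≤ q - 2 := hl ▸ Nat.pow_log_le_self 2 (by omega)
  have hup : q - 2 < 2 ^ (l + 1) := hl ▸ Nat.lt_pow_succ_log_self one_lt_two _
  have hlt : l < 2 ^ l := Nat.lt_two_pow_self
  obtain ⟨t, ht⟩ : ∃ t, q = t + (l + 1) + 1 := ⟨q - l - 2, by omega⟩
  have hlogq : (l : ℝ) ≤ Real.logb 2 q := by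
    rw [Real.le_logb_iff_rpow_le one_lt_two (by positivity), Real.rpow_natCast]
    exact_mod_cast hlow.trans (Nat.sub_le q 2)
  have hlogq1 : 1 ≤ Real.logb 2 q := by
    rw [Real.le_logb_iff_rpow_le one_lt_two (by positivity), Real.rpow_one]
    exact_mod_cast (by omega : 2 ≤ q)
  have hqR : (q : ℝ) = t + (l + 1) + 1 := by exact_mod_cast ht
  have ht0 : 0 < t := by omega
  refine ⟨t, by omega, by linarith, ?_⟩
  refine (hasDictatorshipTest_linearForms (k := l + 1) ht0 le_rfl (by omega) ht).mono ?_
  rw [div_le_div_iff₀ (by positivity) (by positivity)]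
  have hlR : (2 : ℝ) ^ l ≤ q := by exact_mod_cast hlow.trans (Nat.sub_le q 2)
  have hq1 : (1 : ℝ) ≤ q := by exact_mod_cast (by omega : 1 ≤ q)
  calc (2 : ℝ) ^ (l + 1 + 1) * 2 ^ q = 16 * (2 ^ l) ^ 2 * 2 ^ t := by
        rw [ht]
        ring
    _ ≤ 16 * (q : ℝ) ^ 2 * 2 ^ t := by gcongr
    _ ≤ 16 * (q : ℝ) ^ 3 * 2 ^ t := by
        gcongr
        norm_num

/-- `16 q³ < 2 ^ q` forces `q > 16`, and beyond `16` the exponent `q - 4 - 3 log₂ q` grows at a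
linear rate by concavity of the logarithm. -/
lemma amortizedQueryComplexity_le {q : ℕ} (hq : 3 ≤ q) (hs : 16 * (q : ℝ) ^ 3 / 2 ^ q < 1) :
    amortizedQueryComplexity q (16 * (q : ℝ) ^ 3 / 2 ^ q) ≤ 1 + 200 * (Real.logb 2 q / q) := by
  have hq17 : 17 ≤ q := by
    by_contra hlt
    rw [div_lt_one (by positivity)] at hs
    have hs' : 16 * q ^ 3 < 2 ^ q := by exact_mod_cast hs
    interval_cases q <;> omega
  have hqR : (17 : ℝ) ≤ q := by exact_mod_cast hq17
  have hq0 : (0 : ℝ) < q := by linarith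
  set L := Real.logb 2 q with hL
  have hlog16 : Real.logb 2 16 = 4 := by
    rw [show (16 : ℝ) = 2 ^ (4 : ℕ) by norm_num, Real.logb_pow, Real.logb_self_eq_one one_lt_two]
    norm_num
  have hlog : Real.logb 2 (16 * (q : ℝ) ^ 3 / 2 ^ q)⁻¹ = q - 4 - 3 * L := by
    rw [Real.logb_inv, Real.logb_div (by positivity) (by positivity),
      Real.logb_mul (by norm_num) (by positivity), Real.logb_pow, Real.logb_pow, hlog16,
      Real.logb_self_eq_one one_lt_two]
    push_cast
    ring
  have hL4 : 4 ≤ L := by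
    rw [← hlog16]
    exact Real.logb_le_logb_of_le one_lt_two (by norm_num) (by linarith)
  have hLup : L ≤ 4 + (q - 16) / 11 := by
    have h1 : Real.log (q / 16) ≤ q / 16 - 1 := Real.log_le_sub_one_of_pos (by positivity)
    have h2 : L = 4 + Real.log (q / 16) / Real.log 2 := by
      rw [← hlog16, hL, Real.log_div_log, ← Real.logb_mul (by norm_num) (by positivity)]
      congr 1
      ring
    have h3 : Real.log (q / 16) / Real.log 2 ≤ (q - 16) / 11 := by
      rw [div_le_iff₀ (by positivity)]
      nlinarith [Real.log_two_gt_d9]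
    linarith
  rw [amortizedQueryComplexity, hlog]
  have hden : (q : ℝ) / 24 ≤ q - 4 - 3 * L := by linarith
  have hden0 : 0 < (q : ℝ) - 4 - 3 * L := by linarith
  rw [div_le_iff₀ hden0]
  have hLq : 200 * (L / q) * (q / 24) ≤ 200 * (L / q) * (q - 4 - 3 * L) := by gcongr
  have hcancel : 200 * (L / q) * (q / 24) = 200 / 24 * L := by field_simp
  linarith

end DictatorshipTesting

theorem mainTheorem1 :
    (∀ k t : ℕ, 1 ≤ k → t + 1 = 2 ^ k →
      DictatorshipTesting.HasDictatorshipTest t (t + Nat.log 2 (t + 1)) 1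
        (((t : ℝ) + 1) ^ 2 / 2 ^ t)) ∧
    (∃ C : ℝ, 0 < C ∧ ∃ D : ℝ, 0 < D ∧ ∀ q : ℕ, 3 ≤ q →
      (∃ t : ℕ, t ≤ q ∧ (q : ℝ) - D * Real.logb 2 q ≤ t ∧
        DictatorshipTesting.HasDictatorshipTest t q 1 (C * (q : ℝ) ^ 3 / 2 ^ q)) ∧
      (C * (q : ℝ) ^ 3 / 2 ^ q < 1 →
        DictatorshipTesting.amortizedQueryComplexity q (C * (q : ℝ) ^ 3 / 2 ^ q) ≤
          1 + D * (Real.logb 2 q / q))) :=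
  ⟨fun _ _ hk ht => DictatorshipTesting.hasDictatorshipTest_two_pow hk ht,
    16, by norm_num, 200, by norm_num, fun _ hq =>
      ⟨DictatorshipTesting.exists_hasDictatorshipTest hq,
        DictatorshipTesting.amortizedQueryComplexity_le hq⟩⟩
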